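/- **Conventions.** A partial concept on a set $X$ is a map $h:X\to\{0,1,\star\}$, where $h(x)=\star$ means that $h$ is undefined at $x$; its support is $\{x: h(x)\neq\star\}$. A class $H$ of partial concepts shatters a finite set $U\subseteq X$ if every $\tau:U\to\{0,1\}$ is the restriction to $U$ of some $h\in H$; $\mathsf{VC\text{-}dim}(H)$ is the maximal cardinality of a shattered set. A sample $(x_1,y_1),\dots,(x_s,y_s)\in\mathbb R^d\times\{0,1\}$ is $(r,\lambda)$-separable if $x_1,\dots,x_s$ lie in some closed Euclidean ball of radius $r$ and the convex hulls of $\{x_i: y_i=0\}$ and $\{x_i: y_i=1\}$ have Euclidean distance at least $2\lambda$ (no condition if one of them is empty). For $\mathbb S\subseteq\mathbb R^d$ let $\mathbb H_{r,\lambda}(\mathbb S)$ be the set of all $h:\mathbb S\to\{0,1,\star\}$ such that for all $x_1,\dots,x_s$ in the support of $h$ the sample $(x_1,h(x_1)),\dots,(x_s,h(x_s))$ is $(r,\lambda)$-separable. For a single map $m:\mathcal G_n\to\mathbb R^d$ on the set $\mathcal G_n$ of (unlabelled) graphs of order $n$, let $\mathbb H_{r,\lambda}(m)$ be the set of all $h:\mathcal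 G_n\to\{0,1,\star\}$ such that for all $G_1,\dots,G_s$ in the support of $h$ the sample $(m(G_1),h(G_1)),\dots,(m(G_s),h(G_s))$ is $(r,\lambda)$-separable. A simple $T$-layer MPNN of width $d$ maps a graph $G$, all of whose vertices have the same fixed non-zero initial feature $h^{(0)}_v=x_0\in\mathbb R^d$, to $$h_v^{(t)}=\mathsf{mlp}^{(t)}\Bigl(h_v^{(t-1)},\sum_{u\in N(v)}h_u^{(t-1)}\Bigr)\in\mathbb R^d\quad(1\le t\le T),\qquad m(G)=\mathsf{mlp}\Bigl(\sum_{v}h_v^{(T)}\Bigr)\in\mathbb R^d,$$ where $\mathsf{mlp}^{(t)}:\mathbb R^{2d}\to\mathbb R^d$ and $\mathsf{mlp}:\mathbb R^d\to\mathbb R^d$ are multilayer perceptrons of any depth with hidden widths at most $d$ and affine output layer, whose activation function is either $\mathrm{ReLU}(x)=\max(x,0)$ or $\mathsf{lsig}(x)=\max(0,\min(x,1))$. Let $\mathsf{MPNN}(d,T)$ be the set of all these maps $m$ (for a fixed activation function and $x_0$), and let $\mathcal E_{\mathsf{MPNN}}(n,d,T)=\{m(G): G\in\mathcal G_n,\ m\in\mathsf{MPNN}(d,T)\}\subseteq\mathbb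 R^d$ be the set of $d$-dimensional vectors computable by simple $T$-layer MPNNs on $n$-order graphs. **Statement.** There are absolute constants $c,C>0$ such that, for either activation function and for all integers $n,T>0$, there is $d_0$ (depending only on these) such that for every $d\ge d_0$ and every non-zero $x_0\in\mathbb R^d$ the following hold. 1. Let $r=\sqrt{T+1}\,n$, and let $0<\lambda\le r$ with $n\ge r^2/\lambda^2$. Then $$c\,\frac{r^2}{\lambda^2}\le\mathsf{VC\text{-}dim}\bigl(\mathbb H_{r,\lambda}(\mathcal E_{\mathsf{MPNN}}(n,d,T))\bigr)\le C\,\frac{r^2}{\lambda^2}.$$ Moreover $\mathsf{VC\text{-}dim}(\mathbb H_{r,\lambda}(m))\le C r^2/\lambda^2$ for every $m\in\mathsf{MPNN}(d,T)$, and $\mathsf{VC\text{-}dim}(\mathbb H_{r,\lambda}(m))\ge c\,r^2/\lambda^2$ for some $m\in\mathsf{MPNN}(d,T)$. 2. Let $r=\sqrt{T/(T+1)}$, and let $0<\lambda\le 1$ with $n\ge r^2/\lambda^2$. Then $$c\,\frac{1}{\lambda^2}\le\mathsf{VC\text{-}dim}\bigl(\mathbb H_{1,\lambda}(\mathcal E_{\mathsf{MPNN}}(n,d,T))\bigr)\le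 C\,\frac{1}{\lambda^2}.$$ Moreover $\mathsf{VC\text{-}dim}(\mathbb H_{1,\lambda}(m))\le C/\lambda^2$ for every $m\in\mathsf{MPNN}(d,T)$, and $\mathsf{VC\text{-}dim}(\mathbb H_{1,\lambda}(m))\ge c/\lambda^2$ for some $m\in\mathsf{MPNN}(d,T)$. -/

import Mathlib

noncomputable section

namespace MarginMPNN

/-! ### Partial concepts and their VC dimension -/

/-- A partial concept on `X`: the values `0`, `1` and "undefined" are represented by
`some false`, `some true` and `none`. -/
abbrev PartialConcept (X : Type*) := X → Option Bool

/-- `H` shatters the finite set `U` if every 0/1-labelling of `U` is realised on `U` by some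
partial concept of `H` (which is then defined on all of `U`). -/
def Shatters {X : Type*} (H : Set (PartialConcept X)) (U : Finset X) : Prop :=
  ∀ τ : X → Bool, ∃ h ∈ H, ∀ x ∈ U, h x = some (τ x)

/-- The VC dimension of a partial concept class: the largest cardinality of a shattered set,
`⊤` if there are arbitrarily large ones. -/
def vcDim {X : Type*} (H : Set (PartialConcept X)) : ℕ∞ :=
  ⨆ (U : Finset X) (_ : Shatters H U), (U.card : ℕ∞)

/-- The VC dimension of `H` is finite and lies in the real interval `[a, b]`. -/
def VCBetween {X : Type*} (H : Set (PartialConcept X)) (a b : ℝ) : Prop :=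
  ∃ v : ℕ, vcDim H = (v : ℕ∞) ∧ a ≤ (v : ℝ) ∧ (v : ℝ) ≤ b

/-! ### Margin partial concepts -/

/-- The sample `(x i, y i)` is `(r, lam)`-separable: the points lie in some closed Euclidean ball of
radius `r`, and the convex hulls of the two classes are at distance at least `2 * lam` (no condition
if one of the classes is empty). -/
def Separable {ι : Type*} {d : ℕ} (r lam : ℝ) (x : ι → EuclideanSpace ℝ (Fin d)) (y : ι → Bool) :
    Prop :=
  (∃ p, ∀ i, x i ∈ Metric.closedBall p r) ∧
  ∀ a ∈ convexHull ℝ (x '' {i | y i = false}), ∀ b ∈ convexHull ℝ (x '' {i | y i = true}),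
    2 * lam ≤ dist a b

/-- The margin concepts over a set `S` of vectors: the partial concepts on `S` all of whose finite
samples from the support are `(r, lam)`-separable. -/
def marginConcepts {d : ℕ} (r lam : ℝ) (S : Set (EuclideanSpace ℝ (Fin d))) :
    Set (PartialConcept S) :=
  {h | ∀ (s : ℕ) (x : Fin s → S) (y : Fin s → Bool), (∀ i, h (x i) = some (y i)) →
    Separable r lam (fun i => (x i : EuclideanSpace ℝ (Fin d))) y}

/-- The margin concepts over a class `ℰ` of embeddings of the objects `X` (graphs, say): the partial
concepts on `X` all of whose finite samples from the support are mapped to an `(r, lam)`-separable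
sample by some embedding of `ℰ`. -/
def embeddingMarginConcepts {X : Type*} {d : ℕ} (r lam : ℝ)
    (ℰ : Set (X → EuclideanSpace ℝ (Fin d))) : Set (PartialConcept X) :=
  {h | ∀ (s : ℕ) (G : Fin s → X) (y : Fin s → Bool), (∀ i, h (G i) = some (y i)) →
    ∃ emb ∈ ℰ, Separable r lam (fun i => emb (G i)) y}

/-- The set of vectors that a class of embeddings computes. -/
def embeddedVectors {X : Type*} {d : ℕ} (ℰ : Set (X → EuclideanSpace ℝ (Fin d))) :
    Set (EuclideanSpace ℝ (Fin d)) :=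
  {x | ∃ emb ∈ ℰ, ∃ G : X, emb G = x}

/-! ### Simple MPNNs -/

/-- The rectified linear unit. -/
def relu (x : ℝ) : ℝ := max x 0

/-- The linearised sigmoid. -/
def lsig (x : ℝ) : ℝ := max 0 (min x 1)

/-- The parameters of a multilayer perceptron `ℝ^p → ℝ^q` (of any depth) whose hidden layers have
width at most `d`. -/
inductive MLP (d : ℕ) : ℕ → ℕ → Type
  | output {p q : ℕ} (W : Matrix (Fin q) (Fin p) ℝ) (b : Fin q → ℝ) : MLP d p q
  | hidden {p w q : ℕ} (hw : w ≤ d) (W : Matrix (Fin w) (Fin p) ℝ) (b : Fin w → ℝ)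
      (rest : MLP d w q) : MLP d p q

/-- The function computed by a multilayer perceptron with activation function `σ` (applied
coordinatewise in the hidden layers; the output layer is affine). -/
def MLP.eval (σ : ℝ → ℝ) {d : ℕ} : {p q : ℕ} → MLP d p q → (Fin p → ℝ) → (Fin q → ℝ)
  | _, _, .output W b, x => W.mulVec x + b
  | _, _, .hidden _ W b rest, x => rest.eval σ (fun i => σ ((W.mulVec x + b) i))

/-- The parameters of a simple `T`-layer MPNN of width `d`: `update t` is the perceptron
`ℝ^(2d) → ℝ^d` of layer `t + 1`. -/
structure SimpleMPNN (d T : ℕ) where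
  update : Fin T → MLP d (d + d) d
  readout : MLP d d d

open Classical in
/-- The vertex features after `t ≤ T` layers, with initial vertex features `h₀`. The update
perceptron receives the concatenation of the feature of `v` and the sum of the features of the
neighbours of `v`. -/
def SimpleMPNN.feature (σ : ℝ → ℝ) {d T : ℕ} (M : SimpleMPNN d T) {V : Type*} [Fintype V]
    (G : SimpleGraph V) (h₀ : V → Fin d → ℝ) : (t : ℕ) → t ≤ T → V → Fin d → ℝ
  | 0, _, v => h₀ v
  | t + 1, ht, v =>
      (M.update ⟨t, ht⟩).eval σ
        (Fin.append (M.feature σ G h₀ t (Nat.le_of_succ_le ht) v)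
          (∑ u with G.Adj v u, M.feature σ G h₀ t (Nat.le_of_succ_le ht) u))

/-- The graph embedding computed by a simple MPNN. -/
def SimpleMPNN.embed (σ : ℝ → ℝ) {d T : ℕ} (M : SimpleMPNN d T) {V : Type*} [Fintype V]
    (G : SimpleGraph V) (h₀ : V → Fin d → ℝ) : EuclideanSpace ℝ (Fin d) :=
  WithLp.toLp 2 (M.readout.eval σ (∑ v, M.feature σ G h₀ T le_rfl v))

/-- The class of embeddings of (unlabelled) `n`-order graphs computed by simple `T`-layer MPNNs of
width `d`. As the vertices carry no labels, they all have the same initial feature `x₀`. -/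
def mpnnEmbeddings (σ : ℝ → ℝ) (n d T : ℕ) (x₀ : Fin d → ℝ) :
    Set (SimpleGraph (Fin n) → EuclideanSpace ℝ (Fin d)) :=
  {emb | ∃ M : SimpleMPNN d T, emb = fun G => M.embed σ G (fun _ => x₀)}

end MarginMPNN

end

namespace MarginMPNN

/-! ### Bounds on the VC dimension -/

/-! The upper bound is the classical margin bound and uses nothing about MPNNs. Group shattered
points into `k` pairs. Signs chosen greedily keep the signed sum of the pair differences of norm at
most `2r√k`, while the labelling given by these signs has class means at distance at least `2λ`;
hence `k ≤ r²/λ²` (`card_pairs_le_of_separable`).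

For the lower bound, at most `r²/λ²` basis vectors scaled by `r` can be labelled arbitrarily with
margin `λ` (`separable_single`). A single MPNN reaches `n` of them: it computes the degree sum,
which tells apart graphs with `0, …, n - 1` edges, and one hidden readout layer of width `n` turns
this number into a scaled basis vector (`exists_readout`). -/

lemma VCBetween.of_bounds {X : Type*} {H : Set (PartialConcept X)} {a b : ℝ} {U : Finset X}
    (hU : Shatters H U) (ha : a ≤ U.card) (hb : ∀ V : Finset X, Shatters H V → (V.card : ℝ) ≤ b) :
    VCBetween H a b := by
  have hb0 : 0 ≤ b := (Nat.cast_nonneg _).trans (hb U hU)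
  have hle : vcDim H ≤ (⌊b⌋₊ : ℕ∞) :=
    iSup₂_le fun V hV => by exact_mod_cast Nat.le_floor (hb V hV)
  obtain ⟨v, hv⟩ := ENat.ne_top_iff_exists.1 (ne_top_of_le_ne_top (ENat.natCast_ne_top _) hle)
  have hUv : (U.card : ℕ∞) ≤ vcDim H := le_iSup₂ (f := fun (U : Finset X) _ => (U.card : ℕ∞)) U hU
  rw [← hv] at hle hUv
  refine ⟨v, hv.symm, ha.trans ?_, ?_⟩
  · exact_mod_cast hUv
  · exact (Nat.cast_le.2 (by exact_mod_cast hle)).trans (Nat.floor_le hb0)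

/-- Greedy choice of signs: some signed sum has square norm at most the sum of the square norms. -/
lemma exists_sign_norm_sq_sum_le {E ι : Type*} [NormedAddCommGroup E] [InnerProductSpace ℝ E]
    (s : Finset ι) (z : ι → E) :
    ∃ ε : ι → Bool, ‖∑ i ∈ s, (if ε i then z i else -z i)‖ ^ 2 ≤ ∑ i ∈ s, ‖z i‖ ^ 2 := by
  classical
  induction s using Finset.induction_on with
  | empty => exact ⟨fun _ => true, by simp⟩
  | insert j s hj ih =>
    obtain ⟨ε, hε⟩ := ih
    set S := ∑ i ∈ s, (if ε i then z i else -z i) with hS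
    have key : ∀ c : Bool, ∑ i ∈ insert j s,
        (if Function.update ε j c i then z i else -z i) = (if c then z j else -z j) + S := by
      intro c
      rw [Finset.sum_insert hj, Function.update_self, hS]
      congr 1
      refine Finset.sum_congr rfl fun i hi => ?_
      rw [Function.update_of_ne (ne_of_mem_of_not_mem hi hj)]
    -- The sign of `z j` is chosen to make the cross term nonpositive.
    rcases le_total (inner ℝ (z j) S) 0 with h | h
    · refine ⟨Function.update ε j true, ?_⟩
      rw [key, Finset.sum_insert hj, if_pos rfl, norm_add_sq_real]
      linarith
    · refine ⟨Function.update ε j false, ?_⟩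
      rw [key, Finset.sum_insert hj, if_neg (by simp), norm_add_sq_real, inner_neg_left, norm_neg]
      linarith

lemma inv_smul_sum_mem_convexHull {E : Type*} [AddCommGroup E] [Module ℝ E] {k : ℕ} (hk : 0 < k)
    {A : Set E} {p : Fin k → E} (hp : ∀ i, p i ∈ A) : (k : ℝ)⁻¹ • ∑ i, p i ∈ convexHull ℝ A := by
  rw [Finset.smul_sum]
  have : (k : ℝ) ≠ 0 := by positivity
  exact (convex_convexHull ℝ A).sum_mem (fun _ _ => by positivity) (by simp [this])
    fun i _ => subset_convexHull ℝ A (hp i)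

/-- If every labelling of `2k` points is separable, then `k ≤ r ^ 2 / lam ^ 2`. -/
lemma card_pairs_le_of_separable {d k : ℕ} {r lam : ℝ} (hlam : 0 < lam)
    (x : Fin k × Bool → EuclideanSpace ℝ (Fin d)) (h : ∀ y, Separable r lam x y) :
    (k : ℝ) ≤ r ^ 2 / lam ^ 2 := by
  rcases Nat.eq_zero_or_pos k with rfl | hk
  · simp only [Nat.cast_zero]; positivity
  obtain ⟨ε, hε⟩ := exists_sign_norm_sq_sum_le Finset.univ fun i => x (i, true) - x (i, false)
  -- With this labelling, the difference of the two class sums is exactly the signed sum bounded by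
  -- `hε`.
  obtain ⟨⟨c, hc⟩, hsep⟩ := h fun p => p.2 == ε p.1
  have hk' : (0 : ℝ) < k := by exact_mod_cast hk
  have h1 := hsep _ (inv_smul_sum_mem_convexHull hk (p := fun i => x (i, !ε i)) fun i =>
      ⟨(i, !ε i), by simp, rfl⟩)
    _ (inv_smul_sum_mem_convexHull hk (p := fun i => x (i, ε i)) fun i => ⟨(i, ε i), by simp, rfl⟩)
  have hsum : ∑ i, (if ε i then x (i, true) - x (i, false) else -(x (i, true) - x (i, false)))
      = ∑ i, x (i, ε i) - ∑ i, x (i, !ε i) := by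
    rw [← Finset.sum_sub_distrib]
    refine Finset.sum_congr rfl fun i _ => ?_
    cases ε i <;> simp
  rw [hsum] at hε
  rw [dist_comm, dist_eq_norm, ← smul_sub, norm_smul, Real.norm_of_nonneg (by positivity),
    inv_mul_eq_div, le_div_iff₀ hk'] at h1
  have hr : ∀ i, ‖x (i, true) - x (i, false)‖ ^ 2 ≤ (2 * r) ^ 2 := by
    intro i
    have ht := hc (i, true)
    have hf := hc (i, false)
    rw [Metric.mem_closedBall] at ht hf
    rw [← dist_eq_norm]
    exact pow_le_pow_left₀ dist_nonneg ((dist_triangle_right _ _ c).trans (by linarith)) 2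
  have h2 : (2 * lam * k) ^ 2 ≤ k * (2 * r) ^ 2 :=
    (pow_le_pow_left₀ (by positivity) h1 2).trans <| hε.trans <|
      (Finset.sum_le_sum fun i _ => hr i).trans (by simp)
  rw [le_div_iff₀ (by positivity)]
  have h3 : (k : ℝ) * (k * lam ^ 2) ≤ k * r ^ 2 := by linarith
  exact le_of_mul_le_mul_left h3 hk'

/-- A set of points all of whose labellings are realised by partial concepts with separable samples
has at most `3 * (r ^ 2 / lam ^ 2)` elements. -/
lemma card_le_of_shatters {X : Type*} {d : ℕ} {r lam : ℝ} (hlam : 0 < lam) (hr : lam ≤ r)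
    {H : Set (PartialConcept X)} (f : X → EuclideanSpace ℝ (Fin d))
    (hH : ∀ h ∈ H, ∀ (s : ℕ) (x : Fin s → X) (y : Fin s → Bool), (∀ i, h (x i) = some (y i)) →
      Separable r lam (fun i => f (x i)) y)
    {U : Finset X} (hU : Shatters H U) : (U.card : ℝ) ≤ 3 * (r ^ 2 / lam ^ 2) := by
  classical
  set k := U.card / 2 with hk
  have hcard : Fintype.card (Fin k × Bool) ≤ Fintype.card U := by
    simp only [Fintype.card_prod, Fintype.card_fin, Fintype.card_bool, Fintype.card_coe]
    omega
  obtain ⟨g⟩ := Function.Embedding.nonempty_of_card_le hcard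
  let e := Fintype.equivFin (Fin k × Bool)
  have hle : (k : ℝ) ≤ r ^ 2 / lam ^ 2 := by
    refine card_pairs_le_of_separable hlam (fun p => f (g p)) fun y => ?_
    obtain ⟨h, hh, hτ⟩ := hU fun x => if hx : ∃ p, (g p : X) = x then y hx.choose else true
    have hy : ∀ p, h (g p) = some (y p) := by
      intro p
      have hx : ∃ q, (g q : X) = g p := ⟨p, rfl⟩
      rw [hτ _ (g p).2, dif_pos hx, g.injective (Subtype.ext hx.choose_spec)]
    obtain ⟨⟨c, hc⟩, hsep⟩ := hH h hh _ (fun i => g (e.symm i)) (fun i => y (e.symm i))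
      fun i => hy _
    have him : ∀ b : Bool, (fun i => f (g (e.symm i))) '' {i | y (e.symm i) = b}
        = (fun p => f (g p)) '' {p | y p = b} := by
      intro b
      ext v
      constructor
      · rintro ⟨i, hi, rfl⟩
        exact ⟨e.symm i, hi, rfl⟩
      · rintro ⟨p, hp, rfl⟩
        exact ⟨e p, by simpa using hp, by simp⟩
    rw [him, him] at hsep
    exact ⟨⟨c, fun p => by simpa using hc (e p)⟩, hsep⟩
  -- Pairing may leave one point over; `1 ≤ r²/λ²` absorbs it, so the constant is `2 + 1`.
  have h1 : 1 ≤ r ^ 2 / lam ^ 2 := by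
    rw [one_le_div (by positivity)]
    exact pow_le_pow_left₀ hlam.le hr 2
  have h2 : (U.card : ℝ) ≤ 2 * k + 1 := by
    exact_mod_cast (by omega : U.card ≤ 2 * k + 1)
  linarith

/-! ### Shattering scaled basis vectors -/

/-- Every labelling of `r` times `s ≤ r ^ 2 / lam ^ 2` basis vectors is `(r, lam)`-separable. -/
lemma separable_single {ι : Type*} {d : ℕ} {r lam : ℝ} (hr : 0 < r)
    (S : Finset (Fin d)) (hS : S.card * lam ^ 2 ≤ r ^ 2) (g : ι → Fin d) (hg : ∀ i, g i ∈ S)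
    (τ : Fin d → Bool) :
    Separable r lam (fun i => EuclideanSpace.single (g i) r) (fun i => τ (g i)) := by
  classical
  refine ⟨⟨0, fun i => by simp [abs_of_pos hr]⟩, fun a ha b hb => ?_⟩
  -- Normal vector with `‖w‖² = |S|`: the functional `⟨w, ·⟩` is constantly `r` on one hull and `-r`
  -- on the other, so their distance is at least `2r/‖w‖ ≥ 2λ`.
  let w : EuclideanSpace ℝ (Fin d) :=
    WithLp.toLp 2 fun k => if k ∈ S then (if τ k then 1 else -1) else 0
  have hwsq : ‖w‖ ^ 2 = S.card := by
    rw [EuclideanSpace.norm_sq_eq]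
    have : ∀ k, ‖w k‖ ^ 2 = if k ∈ S then 1 else 0 := by
      intro k
      by_cases hk : k ∈ S <;> cases hτ : τ k <;> simp [w, hk, hτ]
    rw [Finset.sum_congr rfl fun k _ => this k]
    simp
  have hval : ∀ (c : Bool) (v : EuclideanSpace ℝ (Fin d)),
      v ∈ convexHull ℝ ((fun i => EuclideanSpace.single (g i) r) '' {i | τ (g i) = c}) →
        inner ℝ w v = (if c then r else -r) := by
    intro c v hv
    have hconv : Convex ℝ {v : EuclideanSpace ℝ (Fin d) | inner ℝ w v = (if c then r else -r)} :=
      convex_hyperplane (innerₛₗ ℝ w).isLinear _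
    refine convexHull_min ?_ hconv hv
    rintro _ ⟨i, hi, rfl⟩
    have hi' : τ (g i) = c := hi
    cases c <;> simp [w, hg i, hi', EuclideanSpace.inner_single_right]
  have h1 := real_inner_le_norm w (b - a)
  rw [inner_sub_right, hval true b hb, hval false a ha, ← dist_eq_norm, dist_comm] at h1
  simp only [if_true, Bool.false_eq_true, if_false, sub_neg_eq_add] at h1
  have h2 : ‖w‖ * lam ≤ r := by
    refine abs_le_of_sq_le_sq' ?_ hr.le |>.2
    rw [mul_pow, hwsq]
    exact hS
  by_contra! hlt
  rcases (norm_nonneg w).eq_or_lt with h0 | h0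
  · rw [← h0] at h1
    linarith
  · nlinarith [mul_lt_mul_of_pos_left hlt h0]

/-- The map `f` covers both uses: the inclusion of a set of vectors and a single graph embedding. -/
lemma vcBetween_of_single {X : Type*} {d n : ℕ} {r lam : ℝ} (hlam : 0 < lam) (hr : lam ≤ r)
    (hn : r ^ 2 / lam ^ 2 / 2 ≤ n) {H : Set (PartialConcept X)}
    (f : X → EuclideanSpace ℝ (Fin d))
    (hH : ∀ h : PartialConcept X, h ∈ H ↔ ∀ (s : ℕ) (x : Fin s → X) (y : Fin s → Bool),
      (∀ i, h (x i) = some (y i)) → Separable r lam (fun i => f (x i)) y)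
    (p : Fin n → X) (q : Fin n ↪ Fin d) (hp : ∀ k, f (p k) = EuclideanSpace.single (q k) r) :
    VCBetween H (1 / 2 * (r ^ 2 / lam ^ 2)) (3 * (r ^ 2 / lam ^ 2)) := by
  classical
  have hr0 : 0 < r := hlam.trans_le hr
  set a := r ^ 2 / lam ^ 2 with ha
  have ha1 : 1 ≤ a := by
    rw [ha, one_le_div (by positivity)]
    exact pow_le_pow_left₀ hlam.le hr 2
  -- Since `a ≥ 1`, rounding up still gives `s ≤ a`, as the margin requires; halving allows the
  -- weaker hypothesis `a / 2 ≤ n`.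
  set s := ⌈a / 2⌉₊ with hs
  have hsn : s ≤ n := Nat.ceil_le.2 hn
  have hsa : (s : ℝ) ≤ a := by
    rcases le_or_gt (a / 2) 1 with h | h
    · have : s ≤ 1 := Nat.ceil_le.2 (by simpa using h)
      exact (Nat.cast_le.2 this).trans (by simpa using ha1)
    · have := Nat.ceil_lt_add_one (a := a / 2) (by linarith)
      linarith
  have hfp : Function.Injective (f ∘ p) := by
    intro i j hij
    simp only [Function.comp_apply, hp] at hij
    have := congrArg (fun v : EuclideanSpace ℝ (Fin d) => v (q i)) hij
    by_contra hne
    have hq : q i ≠ q j := fun h => hne (q.injective h)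
    simp [hq, hr0.ne'] at this
  have hpinj : Function.Injective p := hfp.of_comp
  let P : Fin s ↪ X := ⟨fun i => p (Fin.castLE hsn i), hpinj.comp (Fin.castLE_injective hsn)⟩
  let Q : Fin s ↪ Fin d := (Fin.castLEEmb hsn).trans q
  refine VCBetween.of_bounds (U := Finset.univ.map P) ?_ ?_
    fun V hV => card_le_of_shatters hlam hr f (fun h hh => (hH h).1 hh) hV
  · intro τ
    refine ⟨fun x => if x ∈ Finset.univ.map P then some (τ x) else none, (hH _).2 ?_,
      fun x hx => if_pos hx⟩
    intro m x y hxy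
    have hmem : ∀ i, ∃ j, P j = x i := by
      intro i
      have := hxy i
      split_ifs at this with h
      simpa using h
    choose j hj using hmem
    have hy : ∀ i, y i = τ (P (j i)) := by
      intro i
      have := hxy i
      rw [← hj i, if_pos (by simp)] at this
      exact (Option.some.inj this).symm
    have := separable_single hr0 (Finset.univ.map Q) (by
      rw [Finset.card_map, Finset.card_univ, Fintype.card_fin]
      rwa [ha, le_div_iff₀ (by positivity)] at hsa) (fun i => Q (j i)) (fun i => by simp)
      (fun k => if hk : ∃ l, Q l = k then τ (P hk.choose) else true)
    have hx : (fun i => f (x i)) = fun i => EuclideanSpace.single (Q (j i)) r :=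
      funext fun i => by rw [← hj i]; exact hp _
    have hτ : y = fun i => (if hk : ∃ l, Q l = Q (j i) then τ (P hk.choose) else true) := by
      funext i
      have hk : ∃ l, Q l = Q (j i) := ⟨_, rfl⟩
      rw [dif_pos hk, Q.injective hk.choose_spec, hy]
    rw [hx, hτ]
    exact this
  · rw [Finset.card_map, Finset.card_univ, Fintype.card_fin]
    linarith [Nat.le_ceil (a / 2)]

/-! ### A simple MPNN that separates graphs by their number of edges -/

/-- Any `k ≤ n - 1` edges of the complete graph will do, by the handshake lemma. -/
lemma exists_simpleGraph_sum_degree (n : ℕ) (k : Fin n) :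
    ∃ G : SimpleGraph (Fin n), ∀ [DecidableRel G.Adj],
      ∑ v, (Finset.univ.filter fun u => G.Adj v u).card = 2 * (k : ℕ) := by
  classical
  have hcard : (k : ℕ) ≤ (⊤ : SimpleGraph (Fin n)).edgeFinset.card := by
    rw [SimpleGraph.card_edgeFinset_top_eq_card_choose_two, Fintype.card_fin, Nat.choose_two_right]
    have hk := k.2
    obtain ⟨m, rfl⟩ : ∃ m, n = m + 1 := ⟨n - 1, by omega⟩
    rw [Nat.le_div_iff_mul_le two_pos, Nat.add_sub_cancel]
    rcases Nat.eq_zero_or_pos m with rfl | hm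
    · omega
    · nlinarith
  obtain ⟨t, ht, htk⟩ := Finset.exists_subset_card_eq hcard
  refine ⟨SimpleGraph.fromEdgeSet t, ?_⟩
  intro inst
  have h := (SimpleGraph.fromEdgeSet (t : Set (Sym2 (Fin n)))).sum_degrees_eq_twice_card_edges
  have hedge : ∀ inst : Fintype (SimpleGraph.fromEdgeSet (t : Set (Sym2 (Fin n)))).edgeSet,
      @SimpleGraph.edgeFinset _ (SimpleGraph.fromEdgeSet (t : Set (Sym2 (Fin n)))) inst = t := by
    intro _
    ext e
    rw [SimpleGraph.mem_edgeFinset, SimpleGraph.edgeSet_fromEdgeSet]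
    refine ⟨fun h => h.1, fun h => ⟨h, ?_⟩⟩
    have := ht h
    rw [SimpleGraph.mem_edgeFinset] at this
    exact SimpleGraph.not_isDiag_of_mem_edgeSet _ this
  rw [hedge, htk] at h
  rw [← h]
  refine Finset.sum_congr rfl fun v _ => ?_
  rw [← SimpleGraph.card_neighborFinset_eq_degree]
  congr 1
  ext u
  simp

lemma mulVec_of_single {p q : ℕ} (c : Fin q → Fin p) (a : Fin q → ℝ) (x : Fin p → ℝ) (i : Fin q) :
    (Matrix.of fun i => Pi.single (c i) (a i)).mulVec x i = a i * x (c i) :=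
  single_dotProduct _ _ _

/-- The MPNN whose first layer computes the degrees, whose further layers are the identity, and
whose readout is the given perceptron. -/
noncomputable def degreeMPNN {d : ℕ} (T : ℕ) (x₀ : Fin d → ℝ) (j₀ : Fin d) (readout : MLP d d d) :
    SimpleMPNN d T where
  -- The first layer divides coordinate `j₀` of the neighbour sum by `x₀ j₀ ≠ 0` and writes the
  -- degree into every coordinate. All updates are affine, so `σ` plays no role here.
  update t := .output (Matrix.of fun i => Pi.single
    (if (t : ℕ) = 0 then Fin.natAdd d j₀ else Fin.castAdd d i)
    (if (t : ℕ) = 0 then (x₀ j₀)⁻¹ else 1)) 0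
  readout := readout

lemma degreeMPNN_feature (σ : ℝ → ℝ) {d T : ℕ} {x₀ : Fin d → ℝ} {j₀ : Fin d} (hx : x₀ j₀ ≠ 0)
    (readout : MLP d d d) {V : Type*} [Fintype V] (G : SimpleGraph V) [DecidableRel G.Adj]
    (t : ℕ) (ht : t + 1 ≤ T) (v : V) (i : Fin d) :
    (degreeMPNN T x₀ j₀ readout).feature σ G (fun _ => x₀) (t + 1) ht v i
      = (Finset.univ.filter fun u => G.Adj v u).card := by
  induction t generalizing v i with
  | zero =>
    simp only [SimpleMPNN.feature, degreeMPNN, MLP.eval, Pi.add_apply, mulVec_of_single, if_pos,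
      Fin.append_right]
    simp only [Finset.sum_const, Pi.smul_apply, Pi.zero_apply, add_zero, nsmul_eq_mul]
    field_simp
    congr
  | succ t ih =>
    rw [SimpleMPNN.feature]
    rw [show (degreeMPNN T x₀ j₀ readout).update ⟨t + 1, ht⟩ = .output (Matrix.of fun i => Pi.single
      (Fin.castAdd d i) 1) 0 by simp [degreeMPNN]]
    rw [MLP.eval, Pi.add_apply, mulVec_of_single, Fin.append_left, ih, one_mul, Pi.zero_apply,
      add_zero]

/-- On input `2k`, hidden unit `l` outputs `σ (2k - 2l + 1)`, which is `1` for `l = k` and `0` for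
`l > k`. The hidden vectors are thus the columns of a unitriangular matrix, whose inverse the output
layer applies. -/
lemma exists_readout {σ : ℝ → ℝ} (hσ1 : σ 1 = 1) (hσ0 : ∀ x ≤ 0, σ x = 0) {n d : ℕ} (hnd : n ≤ d)
    (j₀ : Fin d) (r : ℝ) :
    ∃ M : MLP d d d, ∀ (k : Fin n) (x : Fin d → ℝ), x j₀ = 2 * (k : ℝ) →
      M.eval σ x = Pi.single (Fin.castLE hnd k) r := by
  let A : Matrix (Fin n) (Fin n) ℝ := Matrix.of fun l k => σ (2 * (k : ℝ) - 2 * (l : ℝ) + 1)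
  have htri : A.BlockTriangular id := by
    intro l k hkl
    refine hσ0 _ ?_
    have : (k : ℝ) + 1 ≤ l := by exact_mod_cast Fin.lt_def.1 hkl
    linarith
  have hdet : A.det = 1 := by
    rw [Matrix.det_of_isUpperTriangular htri]
    exact Finset.prod_eq_one fun i _ => by simp [A, hσ1]
  have hinv : A⁻¹ * A = 1 := Matrix.nonsing_inv_mul A (by simp [hdet])
  let E : Matrix (Fin d) (Fin n) ℝ := Matrix.of fun i k => if i = Fin.castLE hnd k then r else 0
  refine ⟨.hidden hnd (Matrix.of fun _ => Pi.single j₀ 1) (fun l => 1 - 2 * (l : ℝ))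
    (.output (E * A⁻¹) 0), fun k x hx => ?_⟩
  have hhid : (fun i => σ (((Matrix.of fun _ : Fin n => Pi.single j₀ (1 : ℝ)).mulVec x
      + fun l : Fin n => 1 - 2 * (l : ℝ)) i)) = A.mulVec (Pi.single k 1) := by
    funext l
    rw [Matrix.mulVec_single_one, Pi.add_apply, mulVec_of_single, hx]
    simp only [A, Matrix.col_apply, Matrix.of_apply]
    congr 1
    ring
  simp only [MLP.eval]
  rw [hhid, Matrix.mulVec_mulVec, Matrix.mul_assoc, hinv, Matrix.mul_one, Matrix.mulVec_single_one,
    add_zero]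
  funext i
  simp [E, Matrix.col_apply, Pi.single_apply]

/-- Some simple MPNN maps `n` graphs of order `n` to `r` times distinct basis vectors. -/
lemma exists_mpnnEmbedding_single {σ : ℝ → ℝ} (hσ1 : σ 1 = 1) (hσ0 : ∀ x ≤ 0, σ x = 0)
    {n d T : ℕ} (hT : 0 < T) (hnd : n ≤ d) {x₀ : Fin d → ℝ} (hx₀ : x₀ ≠ 0) (r : ℝ) :
    ∃ emb ∈ mpnnEmbeddings σ n d T x₀, ∃ G : Fin n → SimpleGraph (Fin n), ∀ k,
      emb (G k) = EuclideanSpace.single (Fin.castLE hnd k) r := by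
  classical
  obtain ⟨j₀, hj₀⟩ := Function.ne_iff.1 hx₀
  obtain ⟨R, hR⟩ := exists_readout hσ1 hσ0 hnd j₀ r
  choose G hG using exists_simpleGraph_sum_degree n
  refine ⟨_, ⟨degreeMPNN T x₀ j₀ R, rfl⟩, G, fun k => ?_⟩
  obtain ⟨t, rfl⟩ : ∃ t, T = t + 1 := ⟨T - 1, by omega⟩
  change WithLp.toLp 2 (R.eval σ _) = WithLp.toLp 2 _
  rw [hR k]
  rw [Finset.sum_apply]
  simp only [degreeMPNN_feature σ hj₀]
  exact_mod_cast hG k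

lemma mem_marginConcepts_iff {d : ℕ} {r lam : ℝ} {S : Set (EuclideanSpace ℝ (Fin d))}
    (h : PartialConcept S) :
    h ∈ marginConcepts r lam S ↔ ∀ (s : ℕ) (x : Fin s → S) (y : Fin s → Bool),
      (∀ i, h (x i) = some (y i)) →
        Separable r lam (fun i => (x i : EuclideanSpace ℝ (Fin d))) y := Iff.rfl

lemma mem_embeddingMarginConcepts_singleton_iff {X : Type*} {d : ℕ} {r lam : ℝ}
    {emb : X → EuclideanSpace ℝ (Fin d)} (h : PartialConcept X) :
    h ∈ embeddingMarginConcepts r lam {emb} ↔ ∀ (s : ℕ) (x : Fin s → X) (y : Fin s → Bool),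
      (∀ i, h (x i) = some (y i)) → Separable r lam (fun i => emb (x i)) y := by
  simp [embeddingMarginConcepts]

lemma vcBetween_embeddingMarginConcepts {X : Type*} {d : ℕ} {r lam : ℝ} (hlam : 0 < lam)
    (hr : lam ≤ r) (emb : X → EuclideanSpace ℝ (Fin d)) :
    VCBetween (embeddingMarginConcepts r lam {emb}) 0 (3 * (r ^ 2 / lam ^ 2)) := by
  refine VCBetween.of_bounds (U := ∅) (fun τ => ⟨fun _ => none, ?_, by simp⟩) (by simp)
    fun V hV => card_le_of_shatters hlam hr emb
      (fun h => (mem_embeddingMarginConcepts_singleton_iff h).1) hV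
  rw [mem_embeddingMarginConcepts_singleton_iff]
  intro s x y hxy
  rcases s with _ | s
  · exact ⟨⟨0, fun i => i.elim0⟩, fun a ha => by simp [Set.eq_empty_of_isEmpty] at ha⟩
  · exact absurd (hxy 0) (by simp)

/-- The VC dimension bounds for a margin radius `r` that need not be tied to `n` and `T`. -/
lemma vcBetween_mpnn {σ : ℝ → ℝ} (hσ1 : σ 1 = 1) (hσ0 : ∀ x ≤ 0, σ x = 0)
    {n d T : ℕ} (hT : 0 < T) (hnd : n ≤ d) {x₀ : Fin d → ℝ} (hx₀ : x₀ ≠ 0) {r lam : ℝ}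
    (hlam : 0 < lam) (hr : lam ≤ r) (hn : r ^ 2 / lam ^ 2 / 2 ≤ n) :
    VCBetween (marginConcepts r lam (embeddedVectors (mpnnEmbeddings σ n d T x₀)))
      (1 / 2 * (r ^ 2 / lam ^ 2)) (3 * (r ^ 2 / lam ^ 2)) ∧
    (∀ emb ∈ mpnnEmbeddings σ n d T x₀,
      VCBetween (embeddingMarginConcepts r lam {emb}) 0 (3 * (r ^ 2 / lam ^ 2))) ∧
    (∃ emb ∈ mpnnEmbeddings σ n d T x₀,
      VCBetween (embeddingMarginConcepts r lam {emb})
        (1 / 2 * (r ^ 2 / lam ^ 2)) (3 * (r ^ 2 / lam ^ 2))) := by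
  obtain ⟨emb, hemb, G, hG⟩ := exists_mpnnEmbedding_single hσ1 hσ0 hT hnd hx₀ r
  refine ⟨?_, fun e _ => vcBetween_embeddingMarginConcepts hlam hr e, emb, hemb, ?_⟩
  · exact vcBetween_of_single hlam hr hn _ mem_marginConcepts_iff
      (fun k => ⟨emb (G k), emb, hemb, G k, rfl⟩) (Fin.castLEEmb hnd) hG
  · exact vcBetween_of_single hlam hr hn emb mem_embeddingMarginConcepts_singleton_iff G
      (Fin.castLEEmb hnd) hG

end MarginMPNN

theorem mainTheorem2 :
    ∃ c C : ℝ, 0 < c ∧ 0 < C ∧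
      ∀ σ : ℝ → ℝ, (σ = MarginMPNN.relu ∨ σ = MarginMPNN.lsig) →
      ∀ n T : ℕ, 0 < n → 0 < T →
      ∃ d₀ : ℕ, ∀ d : ℕ, d₀ ≤ d → ∀ x₀ : Fin d → ℝ, x₀ ≠ 0 →
        (∀ r lam : ℝ, r = √((T : ℝ) + 1) * n → 0 < lam → lam ≤ r → r ^ 2 / lam ^ 2 ≤ n →
          MarginMPNN.VCBetween
            (MarginMPNN.marginConcepts r lam
              (MarginMPNN.embeddedVectors (MarginMPNN.mpnnEmbeddings σ n d T x₀)))
            (c * (r ^ 2 / lam ^ 2)) (C * (r ^ 2 / lam ^ 2)) ∧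
          (∀ emb ∈ MarginMPNN.mpnnEmbeddings σ n d T x₀,
            MarginMPNN.VCBetween (MarginMPNN.embeddingMarginConcepts r lam {emb})
              0 (C * (r ^ 2 / lam ^ 2))) ∧
          (∃ emb ∈ MarginMPNN.mpnnEmbeddings σ n d T x₀,
            MarginMPNN.VCBetween (MarginMPNN.embeddingMarginConcepts r lam {emb})
              (c * (r ^ 2 / lam ^ 2)) (C * (r ^ 2 / lam ^ 2)))) ∧
        (∀ r lam : ℝ, r = √((T : ℝ) / (T + 1)) → 0 < lam → lam ≤ 1 → r ^ 2 / lam ^ 2 ≤ n →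
          MarginMPNN.VCBetween
            (MarginMPNN.marginConcepts 1 lam
              (MarginMPNN.embeddedVectors (MarginMPNN.mpnnEmbeddings σ n d T x₀)))
            (c * (1 / lam ^ 2)) (C * (1 / lam ^ 2)) ∧
          (∀ emb ∈ MarginMPNN.mpnnEmbeddings σ n d T x₀,
            MarginMPNN.VCBetween (MarginMPNN.embeddingMarginConcepts 1 lam {emb})
              0 (C * (1 / lam ^ 2))) ∧
          (∃ emb ∈ MarginMPNN.mpnnEmbeddings σ n d T x₀,
            MarginMPNN.VCBetween (MarginMPNN.embeddingMarginConcepts 1 lam {emb})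
              (c * (1 / lam ^ 2)) (C * (1 / lam ^ 2)))) := by
  -- `d₀ = n` leaves room for `n` hidden units and `n` basis vectors.
  refine ⟨1 / 2, 3, by norm_num, by norm_num, fun σ hσ n T _ hT => ⟨n, fun d hd x₀ hx₀ => ?_⟩⟩
  have hσ1 : σ 1 = 1 := by
    rcases hσ with rfl | rfl <;> simp [MarginMPNN.relu, MarginMPNN.lsig]
  have hσ0 : ∀ x ≤ 0, σ x = 0 := by
    intro x hx
    rcases hσ with rfl | rfl
    · simp [MarginMPNN.relu, hx]
    · exact max_eq_left ((min_le_left _ _).trans hx)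
  refine ⟨fun r lam _ hlam hr hn => ?_, fun r lam hr hlam h1 hn => ?_⟩
  · have : 0 ≤ r ^ 2 / lam ^ 2 := by positivity
    exact MarginMPNN.vcBetween_mpnn hσ1 hσ0 hT hd hx₀ hlam hr (by linarith)
  · have hT' : (1 : ℝ) ≤ T := by exact_mod_cast hT
    -- The margin radius is now `1`, and `r` only limits `n`: `T ≥ 1` gives `r² ≥ 1/2`, so `(1/λ²)/2
    -- ≤ r²/λ² ≤ n`.
    have hr2 : 1 / 2 ≤ r ^ 2 := by
      rw [hr, Real.sq_sqrt (by positivity), div_le_div_iff₀ two_pos (by positivity)]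
      linarith
    have hle : (1 : ℝ) ^ 2 / lam ^ 2 / 2 ≤ n := by
      refine le_trans ?_ hn
      rw [one_pow, div_right_comm]
      gcongr
    have := MarginMPNN.vcBetween_mpnn hσ1 hσ0 hT hd hx₀ hlam h1 hle
    rwa [one_pow] at this
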